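/- Let $N\ge 1$, let $\Omega\subseteq\mathbb{R}^N$ be open with finite measure, let $1\le p<\infty$ and let $p'\in\,]1,\infty]$ be the conjugate exponent ($p'=\infty$ if $p=1$). Here $W^{1,p}_0(\Omega)$ is the closure of $C^\infty_c(\Omega)$ in $W^{1,p}(\Omega)$, $Du$ is the weak gradient, and $(\cdot,\cdot)$, $|\cdot|$ are the Euclidean scalar product and norm. Assume that: 1. $H:\mathbb{R}^N\to[0,\infty[$ is convex and, for some $0\le c<d<\infty$, $c\,|z|^p\le H(z)\le d\,|z|^p$ for all $z\in\mathbb{R}^N$; 2. $f:\Omega\times\mathbb{R}\to\mathbb{R}$ is a Carathéodory function with $\sup_{|s|\le t}\|f(\cdot,s)\|_{L^\infty(\Omega)}<\infty$ for every $t>0$; 3. if $p\le N$, there are $\theta,\mu\ge 0$ and a finite $q\ge 1$, with $q\le \frac{Np}{N-p}$ when $p<N$, such that $\mathrm{sign}(t)\,f(x,t)\le\mu\,(|t|+\theta)^{q-1}$ for a.e. $x\in\Omega$ and all $t\in\mathbb{R}$. Put $F(x,t)=\int_0^t f(x,s)\,ds$ and $J(v)=\int_\Omega H(Dv)-F(x,v)\,dx\in\,]-\infty,\infty]$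 for $v\in W^{1,p}_0(\Omega)$. For $u\in W^{1,p}_0(\Omega)$ let $$V_u=\{v\in W^{1,p}_0(\Omega): f(\cdot,u)\,v\in L^1(\Omega)\}.$$ Call $u$ an energy critical point of $J$ if $J(u)<\infty$, $u\in V_u$, and $u$ minimises $J_u(v)=\int_\Omega H(Dv)-f(x,u)\,v\,dx$ over $v\in V_u$. Let $\partial H(z)=\{\xi\in\mathbb{R}^N: H(z+v)-H(z)\ge(\xi,v)\ \forall v\in\mathbb{R}^N\}$. Let $u\in W^{1,p}_0(\Omega)$ be an energy critical point of $J$. Then there exists $\xi\in L^{p'}(\Omega;\mathbb{R}^N)$ such that $$\xi(x)\in\partial H(Du(x))\ \text{ for a.e. }x\in\Omega,\qquad \int_\Omega(\xi,D\varphi)-f(x,u)\,\varphi\,dx=0\quad\forall\varphi\in V_u.\tag{EL}$$ If moreover $H$ is positively $p$-homogeneous, i.e. $H(\lambda z)=\lambda^pH(z)$ for all $\lambda>0$ and $z\in\mathbb{R}^N$, then every $\xi\in L^{p'}(\Omega;\mathbb{R}^N)$ satisfying (EL) fulfils $(\xi,Du)=p\,H(Du)$ a.e. in $\Omega$, and $$p\int_\Omega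 H(Du)\,dx=\int_\Omega f(x,u)\,u\,dx.$$ -/

import Mathlib

open MeasureTheory Filter Topology
open scoped ENNReal ContDiff

namespace EnergyCritical

noncomputable section

/-- The Euclidean space `ℝ^N`. -/
abbrev E (N : ℕ) : Type := EuclideanSpace ℝ (Fin N)

/-- `φ ∈ C^∞_c(Ω)`. -/
structure IsTest {N : ℕ} (Ω : Set (E N)) (φ : E N → ℝ) : Prop where
  smooth : ContDiff ℝ ∞ φ
  compact : HasCompactSupport φ
  supp : tsupport φ ⊆ Ω

/-- `G` is the weak (distributional) gradient of `u` in `Ω`. It is only used for `u` and `G`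
in `L^p(Ω)`, so that all the integrals converge. -/
def IsWeakGrad {N : ℕ} (Ω : Set (E N)) (u : E N → ℝ) (G : E N → E N) : Prop :=
  ∀ φ : E N → ℝ, IsTest Ω φ →
    ∫ x in Ω, u x • gradient φ x = - ∫ x in Ω, φ x • G x

/-- An element of `W^{1,p}_0(Ω)`, the closure of `C^∞_c(Ω)` in `W^{1,p}(Ω)`: (a representative of)
a function in `L^p(Ω)` together with (a representative of) its weak gradient `Du ∈ L^p(Ω; ℝ^N)`,
which is almost everywhere determined by the function. When `Ω` has finite measure
the Poincaré inequality makes `‖Du‖_p` and the full Sobolev norm equivalent on `C^∞_c(Ω)`,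
so that this is also the closure for `‖Du‖_p`. Values outside `Ω` are irrelevant. -/
structure W0 {N : ℕ} (Ω : Set (E N)) (p : ℝ) where
  /-- the function `u` -/
  toFun : E N → ℝ
  /-- the weak gradient `Du` -/
  grad : E N → E N
  memLp : MemLp toFun (ENNReal.ofReal p) (volume.restrict Ω)
  memLp_grad : MemLp grad (ENNReal.ofReal p) (volume.restrict Ω)
  isWeakGrad : IsWeakGrad Ω toFun grad
  approx : ∃ φ : ℕ → E N → ℝ, (∀ n, IsTest Ω (φ n)) ∧
    Tendsto (fun n => eLpNorm (fun x => φ n x - toFun x) (ENNReal.ofReal p)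
      (volume.restrict Ω)) atTop (𝓝 0) ∧
    Tendsto (fun n => eLpNorm (fun x => gradient (φ n) x - grad x) (ENNReal.ofReal p)
      (volume.restrict Ω)) atTop (𝓝 0)

/-- The convex subdifferential `∂H(z) ⊆ ℝ^N`. -/
def subdiff {N : ℕ} (H : E N → ℝ) (z : E N) : Set (E N) :=
  {ξ | ∀ v : E N, inner ℝ ξ v ≤ H (z + v) - H z}

/-- `H : ℝ^N → [0, ∞[` is convex and `c |z|^p ≤ H(z) ≤ d |z|^p`, where `0 ≤ c < d < ∞`. -/
structure GrowthH {N : ℕ} (H : E N → ℝ) (p c d : ℝ) : Prop where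
  nonneg : ∀ z, 0 ≤ H z
  convex : ConvexOn ℝ Set.univ H
  c_nonneg : 0 ≤ c
  c_lt_d : c < d
  lower : ∀ z, c * ‖z‖ ^ p ≤ H z
  upper : ∀ z, H z ≤ d * ‖z‖ ^ p

/-- `H(λ z) = λ^p H(z)` for all `λ > 0`. -/
def PosHomogeneous {N : ℕ} (H : E N → ℝ) (p : ℝ) : Prop :=
  ∀ l : ℝ, 0 < l → ∀ z : E N, H (l • z) = l ^ p * H z

/-- `f : Ω × ℝ → ℝ` is a Carathéodory function (Lebesgue measurable in `x`, continuous in `t`) and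
`sup_{|s| ≤ t} ‖f(·, s)‖_{L^∞(Ω)} < ∞` for all `t > 0`. -/
structure LocBddCaratheodory {N : ℕ} (Ω : Set (E N)) (f : E N → ℝ → ℝ) : Prop where
  meas : ∀ s : ℝ, AEMeasurable (fun x => f x s) (volume.restrict Ω)
  cont : ∀ᵐ x ∂(volume.restrict Ω), Continuous (f x)
  bdd : ∀ t : ℝ, 0 < t → ∃ M : ℝ, ∀ s : ℝ, |s| ≤ t →
    ∀ᵐ x ∂(volume.restrict Ω), |f x s| ≤ M

/-- The one-sided growth condition `sign(t) f(x, t) ≤ μ (|t| + θ)^{q - 1}` for some `θ, μ ≥ 0` and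
some finite `q` with `1 ≤ q ≤ p^*`. It is only used for `p ≤ N`; here `p^* = N p / (N - p)` if
`p < N`, while any finite `q ≥ 1` is allowed if `p = N`. -/
def OneSidedGrowth {N : ℕ} (Ω : Set (E N)) (p : ℝ) (f : E N → ℝ → ℝ) : Prop :=
  ∃ θ μ q : ℝ, 0 ≤ θ ∧ 0 ≤ μ ∧ 1 ≤ q ∧ (p < N → q ≤ N * p / (N - p)) ∧
    ∀ᵐ x ∂(volume.restrict Ω), ∀ t : ℝ, Real.sign t * f x t ≤ μ * (|t| + θ) ^ (q - 1)

/-- `F(x, t) = ∫_0^t f(x, s) ds`. -/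
def primF {N : ℕ} (f : E N → ℝ → ℝ) (x : E N) (t : ℝ) : ℝ := ∫ s in (0 : ℝ)..t, f x s

/-- The functional `J(v) = ∫_Ω H(Dv) - F(x, v) dx`, as the integral of the positive part minus
the integral of the negative part; the latter is finite under the structural assumptions, so that
`J` takes values in `]-∞, ∞]`. -/
def J {N : ℕ} {Ω : Set (E N)} {p : ℝ} (H : E N → ℝ) (f : E N → ℝ → ℝ) (v : W0 Ω p) : EReal :=
  ((∫⁻ x in Ω, ENNReal.ofReal (H (v.grad x) - primF f x (v.toFun x)) : ℝ≥0∞) : EReal) -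
    ((∫⁻ x in Ω, ENNReal.ofReal (-(H (v.grad x) - primF f x (v.toFun x))) : ℝ≥0∞) : EReal)

/-- `V_u = {v ∈ W^{1,p}_0(Ω) : f(·, u) v ∈ L^1(Ω)}`. -/
def V {N : ℕ} {Ω : Set (E N)} {p : ℝ} (f : E N → ℝ → ℝ) (u : W0 Ω p) : Set (W0 Ω p) :=
  {v | Integrable (fun x => f x (u.toFun x) * v.toFun x) (volume.restrict Ω)}

/-- The semilinearised functional `J_u(v) = ∫_Ω H(Dv) - f(x, u) v dx`, used for `v ∈ V_u`. Since
`H(z) ≤ d |z|^p` with `d < ∞`, the integrand is then integrable. -/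
def Jlin {N : ℕ} {Ω : Set (E N)} {p : ℝ} (H : E N → ℝ) (f : E N → ℝ → ℝ) (u v : W0 Ω p) : ℝ :=
  ∫ x in Ω, (H (v.grad x) - f x (u.toFun x) * v.toFun x)

/-- `u` is an energy critical point of `J`: `J(u) < ∞`, `u ∈ V_u`, and `u` minimises
`J_u` on `V_u`. -/
structure IsEnergyCritical {N : ℕ} {Ω : Set (E N)} {p : ℝ} (H : E N → ℝ) (f : E N → ℝ → ℝ)
    (u : W0 Ω p) : Prop where
  finite : J H f u < ⊤
  mem : u ∈ V f u
  min : ∀ v ∈ V f u, Jlin H f u u ≤ Jlin H f u v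

/-- `ξ ∈ L^{p'}(Ω; ℝ^N)` solves the Euler-Lagrange inclusion: `ξ(x) ∈ ∂H(Du(x))` almost everywhere
in `Ω` and `∫_Ω (ξ, Dφ) - f(x, u) φ dx = 0` for all `φ ∈ V_u`. -/
structure SolvesEL {N : ℕ} {Ω : Set (E N)} {p : ℝ} (H : E N → ℝ) (f : E N → ℝ → ℝ)
    (u : W0 Ω p) (ξ : E N → E N) : Prop where
  memLp : MemLp ξ (ENNReal.conjExponent (ENNReal.ofReal p)) (volume.restrict Ω)
  mem_subdiff : ∀ᵐ x ∂(volume.restrict Ω), ξ x ∈ subdiff H (u.grad x)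
  eq : ∀ φ ∈ V f u,
    ∫ x in Ω, (inner ℝ (ξ x) (φ.grad x) - f x (u.toFun x) * φ.toFun x) = 0

end

end EnergyCritical

/-!
Since `u` minimises the convex functional `J_u`, the linear functional `w ↦ ∫ f(x, u) w` on `V_u`
is bounded above by `g ↦ ∫ H(Du + g) - ∫ H(Du)` at `g = Dw`. The latter is convex and, by the
growth of `H`, continuous on all of `L^p`, so that separating its strict epigraph from the graph of
`Dw ↦ ∫ f(x, u) w` yields a continuous functional `L` on `L^p` with the same upper bound and
`L(Dw) = ∫ f(x, u) w` for `w ∈ V_u`. On sets of finite measure, `s ↦ L(1_s v)` is a signed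
measure with a density, and the coordinates of `ξ` are these densities for `v` in an orthonormal
basis. Testing the upper bound with `g = 1_s v`, with `v` in a countable dense set, localises it to
`ξ(x) ∈ ∂H(Du(x))`, and the growth of `H` then gives `ξ ∈ L^{p'}`, so that `ξ` represents `L`
on all of `L^p`. If `H` is positively `p`-homogeneous, the subgradient inequality along
`t ↦ (1 + t) Du` is an equality at `t = 0`, and differentiating there gives Euler's identity.
-/

namespace EnergyCritical

section Separation

variable {X : Type*} [AddCommGroup X] [Module ℝ X] [TopologicalSpace X] {Ψ : X → ℝ}
  {S : Submodule ℝ (X × ℝ)}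

theorem apply_eq_zero_of_forall_le {Y : Type*} [AddCommGroup Y] [Module ℝ Y] {S : Submodule ℝ Y}
    {F : Y →ₗ[ℝ] ℝ} {a : ℝ} (hF : ∀ w ∈ S, a ≤ F w) {w : Y} (hw : w ∈ S) : F w = 0 := by
  by_contra hne
  have h := hF _ (S.smul_mem ((a - 1) / F w) hw)
  rw [map_smul, smul_eq_mul, div_mul_cancel₀ _ hne] at h
  linarith

theorem exists_forall_strictEpigraph_neg [IsTopologicalAddGroup X] [ContinuousSMul ℝ X]
    (hΨ : ConvexOn ℝ Set.univ Ψ) (hΨc : Continuous Ψ) (hS : ∀ w ∈ S, w.2 ≤ Ψ w.1) :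
    ∃ F : X × ℝ →L[ℝ] ℝ, (∀ w ∈ S, F w = 0) ∧ ∀ x t, Ψ x < t → F (x, t) < 0 := by
  have hconv : Convex ℝ {w : X × ℝ | Ψ w.1 < w.2} := by
    simpa using hΨ.convex_strict_epigraph
  have hopen : IsOpen {w : X × ℝ | Ψ w.1 < w.2} :=
    isOpen_lt (hΨc.comp continuous_fst) continuous_snd
  have hdisj : Disjoint {w : X × ℝ | Ψ w.1 < w.2} (S : Set (X × ℝ)) :=
    Set.disjoint_left.2 fun w hw hwS => (hS w hwS).not_gt hw
  obtain ⟨F, a, hlt, hle⟩ := geometric_hahn_banach_open hconv hopen S.convex hdisj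
  refine ⟨F, fun w hw => apply_eq_zero_of_forall_le (F := F.toLinearMap) hle hw, fun x t ht => ?_⟩
  have ha : a ≤ 0 := by simpa using hle 0 S.zero_mem
  exact (hlt (x, t) ht).trans_le ha

/-- The hyperplane separating the subspace `S` from the strict epigraph of `Ψ` is not vertical,
hence is the graph of a functional. -/
theorem exists_continuousLinearMap_le_of_convexOn [IsTopologicalAddGroup X] [ContinuousSMul ℝ X]
    (hΨ : ConvexOn ℝ Set.univ Ψ) (hΨc : Continuous Ψ) (hS : ∀ w ∈ S, w.2 ≤ Ψ w.1) :
    ∃ L : X →L[ℝ] ℝ, (∀ x, L x ≤ Ψ x) ∧ ∀ w ∈ S, L w.1 = w.2 := by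
  obtain ⟨F, hF0, hF⟩ := exists_forall_strictEpigraph_neg hΨ hΨc hS
  have hsplit (x : X) (t : ℝ) : F (x, t) = F (x, 0) + t * F (0, 1) := by
    rw [← smul_eq_mul, ← map_smul, ← map_add]
    simp
  have hvert : F (0, 1) < 0 := by
    have h0 : 0 ≤ Ψ 0 := hS 0 S.zero_mem
    have h := hF 0 (Ψ 0 + 1) (lt_add_one _)
    rw [hsplit, show ((0, 0) : X × ℝ) = 0 from rfl, map_zero, zero_add] at h
    exact (pos_iff_neg_of_mul_neg h).1 (by linarith)
  refine ⟨(-F (0, 1))⁻¹ • F.comp (ContinuousLinearMap.inl ℝ X ℝ), fun x => ?_, fun w hw => ?_⟩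
  · refine le_of_forall_gt_imp_ge_of_dense fun t ht => ?_
    have h := hF x t ht
    rw [hsplit] at h
    change (-F (0, 1))⁻¹ * F (x, 0) ≤ t
    rw [inv_mul_le_iff₀ (neg_pos.2 hvert)]
    linarith
  · have h := hF0 w hw
    rw [← Prod.mk.eta (p := w), hsplit] at h
    change (-F (0, 1))⁻¹ * F (w.1, 0) = w.2
    rw [inv_mul_eq_iff_eq_mul₀ (neg_pos.2 hvert).ne']
    linarith

end Separation

section Density

variable {α : Type*} [MeasurableSpace α] {μ : Measure α} {q : ℝ≥0∞} {F : Type*}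
  [NormedAddCommGroup F]

theorem sum_indicatorConstLp {ι : Type*} {s : ι → Set α} (hs : ∀ i, MeasurableSet (s i))
    (hμs : ∀ i, μ (s i) ≠ ⊤) (hd : Pairwise (Function.onFun Disjoint s)) (v : F) (I : Finset ι) :
    ∑ i ∈ I, indicatorConstLp q (hs i) (hμs i) v =
      indicatorConstLp q (I.measurableSet_biUnion fun i _ => hs i)
        (measure_biUnion_lt_top I.finite_toSet fun i _ => (hμs i).lt_top).ne v := by
  classical
  induction I using Finset.induction_on with
  | empty => simp
  | insert a I ha ih =>
    have hdisj : Disjoint (s a) (⋃ i ∈ I, s i) :=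
      Set.disjoint_iUnion₂_right.2 fun i hi => hd (ne_of_mem_of_not_mem hi ha).symm
    rw [Finset.sum_insert ha, ih, ← indicatorConstLp_disjoint_union _ _ _ _ hdisj]
    congr 1
    rw [Finset.set_biUnion_insert]

theorem hasSum_indicatorConstLp [Fact (1 ≤ q)] (hq : q ≠ ⊤) {s : ℕ → Set α}
    (hs : ∀ i, MeasurableSet (s i)) (hμs : ∀ i, μ (s i) ≠ ⊤)
    (hd : Pairwise (Function.onFun Disjoint s)) (hμU : μ (⋃ i, s i) ≠ ⊤) (v : F) :
    HasSum (fun i => indicatorConstLp q (hs i) (hμs i) v)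
      (indicatorConstLp q (MeasurableSet.iUnion hs) hμU v) := by
  rw [HasSum]
  simp only [sum_indicatorConstLp hs hμs hd]
  refine tendsto_indicatorConstLp_set hq ?_
  rw [measure_iUnion hd hs] at hμU
  refine tendsto_of_tendsto_of_tendsto_of_le_of_le tendsto_const_nhds
    (ENNReal.tendsto_tsum_compl_atTop_zero hμU) (fun _ => zero_le) fun I => ?_
  refine (measure_mono ?_).trans (measure_iUnion_le (fun i : {i // i ∉ I} => s i))
  rintro x (⟨hxI, hxU⟩ | ⟨hxU, hxI⟩)
  · exact absurd (Set.iUnion₂_subset_iUnion _ s hxI) hxU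
  · obtain ⟨i, hi⟩ := Set.mem_iUnion.1 hxU
    exact Set.mem_iUnion.2 ⟨⟨i, fun hiI => hxI (Set.mem_iUnion₂.2 ⟨i, hiI, hi⟩)⟩, hi⟩

variable [NormedSpace ℝ F]

/-- The map `v ↦ 1_s v` into `L^q`, for a set `s` of finite measure, as a linear map. -/
noncomputable def indicatorConstLpₗ (q : ℝ≥0∞) {s : Set α} (hs : MeasurableSet s) (hμs : μ s ≠ ⊤) :
    F →ₗ[ℝ] Lp F q μ where
  toFun := indicatorConstLp q hs hμs
  map_add' _ _ := indicatorConstLp_add.symm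
  map_smul' a v := by
    rw [indicatorConstLp, indicatorConstLp, RingHom.id_apply, ← MemLp.toLp_const_smul]
    congr 1
    ext1 x
    exact Set.indicator_const_smul_apply s a (fun _ => v) x

variable [Fact (1 ≤ q)]

open Classical in
/-- The signed measure `s ↦ L (1_{s ∩ D} v)` induced by a functional `L` on `L^q`. Cutting down to
a set `D` of finite measure makes it defined on all measurable sets, even when `μ` is infinite. -/
noncomputable def inducedMeasure (hq : q ≠ ⊤) (L : Lp F q μ →L[ℝ] ℝ) {D : Set α}
    (hD : MeasurableSet D) (hμD : μ D ≠ ⊤) (v : F) : SignedMeasure α where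
  measureOf' s := if hs : MeasurableSet s then
    L (indicatorConstLp q (hs.inter hD) (measure_inter_ne_top_of_right_ne_top hμD) v) else 0
  empty' := by simp
  not_measurable' s hs := dif_neg hs
  m_iUnion' s hs hd := by
    simp only [hs, MeasurableSet.iUnion hs, dif_pos, Set.iUnion_inter]
    exact (hasSum_indicatorConstLp hq (fun i => (hs i).inter hD) _
      (fun i j hij => (hd hij).mono Set.inter_subset_left Set.inter_subset_left) _ v).mapL L

theorem inducedMeasure_apply (hq : q ≠ ⊤) (L : Lp F q μ →L[ℝ] ℝ) {D : Set α}
    (hD : MeasurableSet D) (hμD : μ D ≠ ⊤) (v : F) {s : Set α} (hs : MeasurableSet s) :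
    inducedMeasure hq L hD hμD v s =
      L (indicatorConstLp q (hs.inter hD) (measure_inter_ne_top_of_right_ne_top hμD) v) :=
  dif_pos hs

theorem inducedMeasure_absolutelyContinuous (hq : q ≠ ⊤) (L : Lp F q μ →L[ℝ] ℝ) {D : Set α}
    (hD : MeasurableSet D) (hμD : μ D ≠ ⊤) (v : F) :
    inducedMeasure hq L hD hμD v ≪ᵥ μ.toENNRealVectorMeasure := by
  refine VectorMeasure.AbsolutelyContinuous.mk fun s hs h => ?_
  rw [Measure.toENNRealVectorMeasure_apply_measurable hs] at h
  have hind : indicatorConstLp q (hs.inter hD) (measure_inter_ne_top_of_right_ne_top hμD) v = 0 :=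
    Lp.eq_zero_iff_ae_eq_zero.2 <| indicatorConstLp_coeFn.trans <|
      indicator_meas_zero (measure_inter_null_of_null_left D h)
  rw [inducedMeasure_apply hq L hD hμD v hs, hind, map_zero]

theorem exists_setIntegral_eq_apply_indicatorConstLp [SigmaFinite μ] (hq : q ≠ ⊤)
    (L : Lp F q μ →L[ℝ] ℝ) {D : Set α} (hD : MeasurableSet D) (hμD : μ D ≠ ⊤) (v : F) :
    ∃ g : α → ℝ, Measurable g ∧ Integrable g μ ∧ ∀ s (hs : MeasurableSet s) (hμs : μ s ≠ ⊤),
      s ⊆ D → L (indicatorConstLp q hs hμs v) = ∫ x in s, g x ∂μ := by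
  refine ⟨(inducedMeasure hq L hD hμD v).rnDeriv μ, SignedMeasure.measurable_rnDeriv _ _,
    SignedMeasure.integrable_rnDeriv _ _, fun s hs hμs hsD => ?_⟩
  rw [← withDensityᵥ_apply (SignedMeasure.integrable_rnDeriv _ _) hs,
    SignedMeasure.withDensityᵥ_rnDeriv_eq _ _ (inducedMeasure_absolutelyContinuous hq L hD hμD v),
    inducedMeasure_apply hq L hD hμD v hs]
  simp only [Set.inter_eq_self_of_subset_left hsD]

end Density

section VectorDensity

variable {α : Type*} [MeasurableSpace α] {μ : Measure α} {q : ℝ≥0∞} [Fact (1 ≤ q)] {F : Type*}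
  [NormedAddCommGroup F] [InnerProductSpace ℝ F]

/-- `ξ` is a density on `D` of the functional `L` on `L^q`, i.e. it represents `L` on the multiples
of indicators of subsets of `D`. Since `s ↦ L (1_s v)` need not extend to a finite measure on all of
`α`, densities are first built on sets of finite measure. -/
structure IsDensityOn (L : Lp F q μ →L[ℝ] ℝ) (ξ : α → F) (D : Set α) : Prop where
  integrableOn : IntegrableOn ξ D μ
  apply_indicator : ∀ {s} (hs : MeasurableSet s) (hμs : μ s ≠ ⊤) (v : F), s ⊆ D →
    L (indicatorConstLp q hs hμs v) = ∫ x in s, inner ℝ (ξ x) v ∂μ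

theorem IsDensityOn.congr {L : Lp F q μ →L[ℝ] ℝ} {ξ η : α → F} {D : Set α}
    (hξ : IsDensityOn L ξ D) (hD : MeasurableSet D) (h : Set.EqOn ξ η D) :
    IsDensityOn L η D where
  integrableOn := hξ.integrableOn.congr_fun h hD
  apply_indicator hs hμs v hsD := by
    rw [hξ.apply_indicator hs hμs v hsD]
    exact setIntegral_congr_fun hs fun x hx => by simp only [h (hsD hx)]

theorem eq_of_isDensityOn (hq : q ≠ ⊤) {L M : Lp F q μ →L[ℝ] ℝ} {ξ : α → F} {D : ℕ → Set α}
    (hD : ∀ n, MeasurableSet (D n)) (hd : Pairwise (Function.onFun Disjoint D))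
    (hU : ⋃ n, D n = Set.univ) (hL : ∀ n, IsDensityOn L ξ (D n))
    (hM : ∀ n, IsDensityOn M ξ (D n)) : L = M := by
  ext g
  refine Lp.induction hq (motive := fun g => L g = M g) ?_ ?_ ?_ g
  · intro v s hs hμs
    have hμ (n) : μ (s ∩ D n) ≠ ⊤ := measure_inter_ne_top_of_left_ne_top hμs.ne
    have hsU : ⋃ n, s ∩ D n = s := by rw [← Set.inter_iUnion, hU, Set.inter_univ]
    have hsum := hasSum_indicatorConstLp hq (fun n => hs.inter (hD n)) hμ
      (fun i j hij => (hd hij).mono Set.inter_subset_right Set.inter_subset_right)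
      (by rw [hsU]; exact hμs.ne) v
    simp only [hsU] at hsum
    have hLM (n) : L (indicatorConstLp q (hs.inter (hD n)) (hμ n) v) =
        M (indicatorConstLp q (hs.inter (hD n)) (hμ n) v) := by
      rw [(hL n).apply_indicator _ _ v Set.inter_subset_right,
        (hM n).apply_indicator _ _ v Set.inter_subset_right]
    rw [Lp.simpleFunc.coe_indicatorConst]
    refine (hsum.mapL L).unique ?_
    simpa only [hLM] using hsum.mapL M
  · intro g h hg hh _ hgLM hhLM
    rw [map_add, map_add, hgLM, hhLM]
  · exact isClosed_eq L.continuous M.continuous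

/-- The functional `g ↦ ∫ ⟨ξ, g⟩` on `L^q` defined by `ξ ∈ L^{q'}`. -/
noncomputable def innerLp (q : ℝ≥0∞) [Fact (1 ≤ q)] {q' : ℝ≥0∞} [Fact (1 ≤ q')]
    [ENNReal.HolderConjugate q' q] {ξ : α → F} (hξ : MemLp ξ q' μ) : Lp F q μ →L[ℝ] ℝ :=
  (innerSL ℝ).lpPairing μ q' q (hξ.toLp ξ)

section InnerLp

variable {q' : ℝ≥0∞} [Fact (1 ≤ q')] [ENNReal.HolderConjugate q' q] {ξ : α → F}

theorem innerLp_apply (hξ : MemLp ξ q' μ) (g : Lp F q μ) :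
    innerLp q hξ g = ∫ x, inner ℝ (ξ x) (g x) ∂μ := by
  rw [innerLp, ContinuousLinearMap.lpPairing_eq_integral]
  exact integral_congr_ae (hξ.coeFn_toLp.mono fun x hx => by simp only [hx]; rfl)

theorem isDensityOn_innerLp (hξ : MemLp ξ q' μ) {D : Set α} (hμD : μ D ≠ ⊤) :
    IsDensityOn (innerLp q hξ) ξ D where
  integrableOn := by
    have : IsFiniteMeasure (μ.restrict D) := ⟨by simpa using hμD.lt_top⟩
    exact hξ.restrict D |>.integrable Fact.out
  apply_indicator {s} hs hμs v _ := by
    rw [innerLp_apply, ← integral_indicator hs]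
    refine integral_congr_ae ?_
    filter_upwards [indicatorConstLp_coeFn (p := q) (hs := hs) (hμs := hμs) (c := v)] with x hx
    by_cases hxs : x ∈ s <;> simp [hx, hxs]

end InnerLp

variable [SigmaFinite μ] [FiniteDimensional ℝ F] [MeasurableSpace F] [BorelSpace F]

theorem exists_isDensityOn (hq : q ≠ ⊤) (L : Lp F q μ →L[ℝ] ℝ) {D : Set α}
    (hD : MeasurableSet D) (hμD : μ D ≠ ⊤) : ∃ ξ : α → F, Measurable ξ ∧ IsDensityOn L ξ D := by
  set b := stdOrthonormalBasis ℝ F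
  choose g hgm hgi hgL using fun i => exists_setIntegral_eq_apply_indicatorConstLp hq L hD hμD (b i)
  have hgi' (i) : Integrable (fun x => g i x • b i) μ := (hgi i).smul_const _
  refine ⟨fun x => ∑ i, g i x • b i, Finset.measurable_fun_sum _ fun i _ => (hgm i).smul_const _,
    (integrable_finsetSum _ fun i _ => hgi' i).integrableOn, fun {s} hs hμs v hsD => ?_⟩
  calc L (indicatorConstLp q hs hμs v)
      = L (indicatorConstLpₗ q hs hμs (∑ i, inner ℝ (b i) v • b i)) := by
        rw [b.sum_repr']; rfl
    _ = ∑ i, inner ℝ (b i) v * L (indicatorConstLp q hs hμs (b i)) := by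
        simp only [map_sum, map_smul, smul_eq_mul]; rfl
    _ = ∑ i, ∫ x in s, inner ℝ (g i x • b i) v ∂μ := by
        simp only [hgL _ s hs hμs hsD, real_inner_smul_left, integral_mul_const, mul_comm]
    _ = ∫ x in s, inner ℝ (∑ i, g i x • b i) v ∂μ := by
        simp only [sum_inner]
        exact (integral_finsetSum _ fun i _ => ((hgi' i).inner_const v).restrict).symm

theorem exists_forall_isDensityOn (hq : q ≠ ⊤) (L : Lp F q μ →L[ℝ] ℝ) {D : ℕ → Set α}
    (hD : ∀ n, MeasurableSet (D n)) (hμD : ∀ n, μ (D n) ≠ ⊤)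
    (hd : Pairwise (Function.onFun Disjoint D)) :
    ∃ ξ : α → F, ∀ n, IsDensityOn L ξ (D n) := by
  choose η hηm hη using fun n => exists_isDensityOn hq L (hD n) (hμD n)
  obtain ⟨ξ, -, hξ⟩ := exists_measurable_piecewise D hD η hηm fun i j hij x hx =>
    ((hd hij).le_bot hx).elim
  exact ⟨ξ, fun n => (hη n).congr (hD n) (hξ n).symm⟩

end VectorDensity

theorem integral_norm_rpow_eq {α F : Type*} [MeasurableSpace α] {μ : Measure α}
    [NormedAddCommGroup F] {p : ℝ} (hp : 0 < p) (g : Lp F (ENNReal.ofReal p) μ) :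
    ∫ x, ‖g x‖ ^ p ∂μ = ‖g‖ ^ p := by
  have hnonneg : 0 ≤ ∫ x, ‖g x‖ ^ p ∂μ := integral_nonneg fun x => by positivity
  have h := (Lp.memLp g).eLpNorm_eq_integral_rpow_norm (by simpa using hp) ENNReal.ofReal_ne_top
  rw [ENNReal.toReal_ofReal hp.le] at h
  rw [Lp.norm_def, h, ENNReal.toReal_ofReal (by positivity), Real.rpow_inv_rpow hnonneg hp.ne']

theorem mem_subdiff_of_denseRange {N : ℕ} {H : E N → ℝ} (hH : Continuous H) {ι : Type*}
    {D : ι → E N} (hD : DenseRange D) {z ξ : E N}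
    (h : ∀ i, inner ℝ ξ (D i) ≤ H (z + D i) - H z) : ξ ∈ subdiff H z :=
  fun v => hD.induction_on v (isClosed_le (by fun_prop) (by fun_prop)) h

theorem one_le_of_fact {p : ℝ} [Fact (1 ≤ ENNReal.ofReal p)] : 1 ≤ p :=
  ENNReal.one_le_ofReal.1 Fact.out

section Energy

variable {α F : Type*} [MeasurableSpace α] {μ : Measure α} [NormedAddCommGroup F] {q : ℝ≥0∞}

/-- The integral functional `g ↦ ∫ H(g)` on `L^q`. -/
noncomputable def energy (H : F → ℝ) (g : Lp F q μ) : ℝ := ∫ x, H (g x) ∂μ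

theorem energy_toLp (H : F → ℝ) {G : α → F} (hG : MemLp G q μ) :
    energy H (hG.toLp G) = ∫ x, H (G x) ∂μ :=
  integral_congr_ae (hG.coeFn_toLp.fun_comp H)

theorem convexOn_energy [NormedSpace ℝ F] {H : F → ℝ} (hH : ConvexOn ℝ Set.univ H)
    (hint : ∀ g : Lp F q μ, Integrable (fun x => H (g x)) μ) :
    ConvexOn ℝ Set.univ (energy H : Lp F q μ → ℝ) := by
  refine ⟨convex_univ, fun g _ h _ a b ha hb hab => ?_⟩
  calc energy H (a • g + b • h)
      ≤ ∫ x, a * H (g x) + b * H (h x) ∂μ := by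
        refine integral_mono_ae (hint _) (((hint g).const_mul a).add ((hint h).const_mul b)) ?_
        filter_upwards [Lp.coeFn_add (a • g) (b • h), Lp.coeFn_smul a g, Lp.coeFn_smul b h]
          with x hadd hg hh
        rw [hadd, Pi.add_apply, hg, hh]
        exact hH.2 (Set.mem_univ _) (Set.mem_univ _) ha hb hab
    _ = a • energy H g + b • energy H h := by
        rw [integral_add ((hint g).const_mul a) ((hint h).const_mul b), integral_const_mul,
          integral_const_mul]
        rfl

end Energy

namespace GrowthH

variable {N : ℕ} {H : E N → ℝ} {p c d : ℝ} {α : Type*} [MeasurableSpace α] {μ : Measure α}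

theorem d_pos (hH : GrowthH H p c d) : 0 < d := hH.c_nonneg.trans_lt hH.c_lt_d

protected theorem continuous (hH : GrowthH H p c d) : Continuous H :=
  continuousOn_univ.1 (hH.convex.continuousOn isOpen_univ)

theorem integrable_comp (hH : GrowthH H p c d) (hp : 0 < p) {G : α → E N}
    (hG : MemLp G (ENNReal.ofReal p) μ) : Integrable (fun x => H (G x)) μ := by
  have h := hG.integrable_norm_rpow (by simpa using hp) ENNReal.ofReal_ne_top
  rw [ENNReal.toReal_ofReal hp.le] at h
  refine (h.const_mul d).mono' (hH.continuous.comp_aestronglyMeasurable hG.1)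
    (ae_of_all _ fun x => ?_)
  rw [Real.norm_of_nonneg (hH.nonneg _)]
  exact hH.upper _

theorem energy_le (hH : GrowthH H p c d) (hp : 0 < p) (g : Lp (E N) (ENNReal.ofReal p) μ) :
    energy H g ≤ d * ‖g‖ ^ p := by
  have h := (Lp.memLp g).integrable_norm_rpow (by simpa using hp) ENNReal.ofReal_ne_top
  rw [ENNReal.toReal_ofReal hp.le] at h
  rw [← integral_norm_rpow_eq hp, ← integral_const_mul]
  exact integral_mono (hH.integrable_comp hp (Lp.memLp g)) (h.const_mul d) fun x => hH.upper _

theorem convexOn_energy (hH : GrowthH H p c d) (hp : 0 < p) :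
    ConvexOn ℝ Set.univ (energy H : Lp (E N) (ENNReal.ofReal p) μ → ℝ) :=
  EnergyCritical.convexOn_energy hH.convex fun g => hH.integrable_comp hp (Lp.memLp g)

theorem continuous_energy (hH : GrowthH H p c d) [Fact (1 ≤ ENNReal.ofReal p)] :
    Continuous (energy H : Lp (E N) (ENNReal.ofReal p) μ → ℝ) := by
  have hp : 0 < p := zero_lt_one.trans_le one_le_of_fact
  have hbdd (G : Lp (E N) (ENNReal.ofReal p) μ) : (𝓝 G).IsBoundedUnder (· ≤ ·) (energy H) := by
    have hlim : Tendsto (fun g : Lp (E N) (ENNReal.ofReal p) μ => d * ‖g‖ ^ p) (𝓝 G)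
        (𝓝 (d * ‖G‖ ^ p)) :=
      (continuous_norm.rpow_const fun _ => Or.inr hp.le).continuousAt.const_mul d
    exact hlim.isBoundedUnder_le.mono_le (.of_forall fun g => hH.energy_le hp g)
  have hcont := ((hH.convexOn_energy hp (μ := μ)).continuousOn_tfae isOpen_univ
    Set.univ_nonempty).out 1 4
  exact continuousOn_univ.1 (hcont.2 fun G _ => hbdd G)

/-- Test the subgradient inequality at `v = (t / ‖ξ‖) • ξ` for `t > ‖z‖`, and let `t → ‖z‖`. -/
theorem norm_le_of_mem_subdiff (hH : GrowthH H p c d) (hp : 1 ≤ p) {z ξ : E N}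
    (hξ : ξ ∈ subdiff H z) : ‖ξ‖ ≤ d * 2 ^ p * ‖z‖ ^ (p - 1) := by
  have hd := hH.d_pos
  rcases eq_or_ne ξ 0 with rfl | hξ0
  · rw [norm_zero]
    positivity
  have hn : 0 < ‖ξ‖ := norm_pos_iff.2 hξ0
  have key (t : ℝ) (hzt : ‖z‖ < t) : ‖ξ‖ ≤ d * 2 ^ p * t ^ (p - 1) := by
    have ht : 0 < t := (norm_nonneg z).trans_lt hzt
    have hnorm : ‖z + (t / ‖ξ‖) • ξ‖ ≤ 2 * t := by
      refine (norm_add_le _ _).trans ?_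
      rw [norm_smul, Real.norm_of_nonneg (by positivity), div_mul_cancel₀ _ hn.ne']
      linarith
    refine le_of_mul_le_mul_left ?_ ht
    calc t * ‖ξ‖ = inner ℝ ξ ((t / ‖ξ‖) • ξ) := by
          rw [inner_smul_right, real_inner_self_eq_norm_sq]
          field_simp
      _ ≤ H (z + (t / ‖ξ‖) • ξ) - H z := hξ _
      _ ≤ d * ‖z + (t / ‖ξ‖) • ξ‖ ^ p := (sub_le_self _ (hH.nonneg z)).trans (hH.upper _)
      _ ≤ d * (2 * t) ^ p := by gcongr
      _ = t * (d * 2 ^ p * t ^ (p - 1)) := by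
          rw [Real.mul_rpow zero_le_two ht.le, Real.rpow_sub_one ht.ne']
          field_simp
  have hlim : Tendsto (fun t : ℝ => d * 2 ^ p * t ^ (p - 1)) (𝓝[>] ‖z‖)
      (𝓝 (d * 2 ^ p * ‖z‖ ^ (p - 1))) :=
    ((Real.continuous_rpow_const (sub_nonneg.2 hp)).tendsto ‖z‖).mono_left nhdsWithin_le_nhds
      |>.const_mul _
  exact ge_of_tendsto hlim (eventually_mem_nhdsWithin.mono key)

end GrowthH

theorem div_sub_one_eq_conjExponent {q : ℝ≥0∞} (hq : 1 ≤ q) (hq' : q ≠ ⊤) :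
    q / (q - 1) = ENNReal.conjExponent q := by
  have : ENNReal.HolderConjugate q (ENNReal.conjExponent q) := .conjExponent hq
  rw [← ENNReal.HolderConjugate.div_conj_eq_sub_one (p := q) (q := ENNReal.conjExponent q)]
  exact ENNReal.div_div_cancel (zero_lt_one.trans_le hq).ne' hq'

theorem GrowthH.memLp_of_mem_subdiff {N : ℕ} {H : E N → ℝ} {p c d : ℝ} {α : Type*}
    [MeasurableSpace α] {μ : Measure α} (hH : GrowthH H p c d) (hp : 1 ≤ p) {G ξ : α → E N}
    (hG : MemLp G (ENNReal.ofReal p) μ) (hm : AEStronglyMeasurable ξ μ)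
    (hξ : ∀ᵐ x ∂μ, ξ x ∈ subdiff H (G x)) :
    MemLp ξ (ENNReal.conjExponent (ENNReal.ofReal p)) μ := by
  have h := (hG.norm_rpow_div (ENNReal.ofReal (p - 1))).const_mul (d * 2 ^ p)
  rw [ENNReal.ofReal_sub _ zero_le_one, ENNReal.ofReal_one, div_sub_one_eq_conjExponent
    (by simpa using hp) ENNReal.ofReal_ne_top, ENNReal.toReal_sub_of_le (by simpa using hp)
    ENNReal.ofReal_ne_top, ENNReal.toReal_ofReal (by linarith), ENNReal.toReal_one] at h
  exact h.mono' hm (hξ.mono fun x hx => hH.norm_le_of_mem_subdiff hp hx)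

section Selection

variable {α : Type*} [MeasurableSpace α] {μ : Measure α} {N : ℕ} {H : E N → ℝ} {p c d : ℝ}

theorem GrowthH.energy_add_indicator_sub (hH : GrowthH H p c d) (hp : 0 < p)
    (G : Lp (E N) (ENNReal.ofReal p) μ) {s : Set α} (hs : MeasurableSet s) (hμs : μ s ≠ ⊤)
    (v : E N) :
    energy H (G + indicatorConstLp _ hs hμs v) - energy H G =
      ∫ x in s, (H (G x + v) - H (G x)) ∂μ := by
  rw [energy, energy, ← integral_sub (hH.integrable_comp hp (Lp.memLp _))
    (hH.integrable_comp hp (Lp.memLp G)), ← integral_indicator hs]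
  refine integral_congr_ae ?_
  filter_upwards [Lp.coeFn_add G (indicatorConstLp (ENNReal.ofReal p) hs hμs v),
    indicatorConstLp_coeFn (p := ENNReal.ofReal p) (hs := hs) (hμs := hμs) (c := v)] with x hadd hv
  rw [hadd, Pi.add_apply, hv]
  by_cases hx : x ∈ s <;> simp [hx]

variable [Fact (1 ≤ ENNReal.ofReal p)] {G : Lp (E N) (ENNReal.ofReal p) μ}
  {L : Lp (E N) (ENNReal.ofReal p) μ →L[ℝ] ℝ}

theorem IsDensityOn.ae_inner_le {ξ : α → E N} {D : Set α} (hξ : IsDensityOn L ξ D)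
    (hH : GrowthH H p c d) (hL : ∀ g, L g ≤ energy H (G + g) - energy H G)
    (hD : MeasurableSet D) (hμD : μ D ≠ ⊤) (v : E N) :
    ∀ᵐ x ∂μ.restrict D, inner ℝ (ξ x) v ≤ H (G x + v) - H (G x) := by
  have hp : 0 < p := zero_lt_one.trans_le one_le_of_fact
  have hfin : IsFiniteMeasure (μ.restrict D) := ⟨by simpa using hμD.lt_top⟩
  have hG : MemLp G (ENNReal.ofReal p) (μ.restrict D) := (Lp.memLp G).restrict D
  have hGv : MemLp (fun x => G x + v) (ENNReal.ofReal p) (μ.restrict D) := hG.add (memLp_const v)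
  refine ae_le_of_forall_setIntegral_le (hξ.integrableOn.inner_const v)
    ((hH.integrable_comp hp hGv).sub (hH.integrable_comp hp hG)) fun s hs _ => ?_
  have hμsD : μ (s ∩ D) ≠ ⊤ := measure_inter_ne_top_of_right_ne_top hμD
  rw [Measure.restrict_restrict hs,
    ← hξ.apply_indicator (hs.inter hD) hμsD v Set.inter_subset_right]
  exact (hL _).trans_eq (hH.energy_add_indicator_sub hp G (hs.inter hD) hμsD v)

theorem IsDensityOn.ae_mem_subdiff {ξ : α → E N} {D : Set α} (hξ : IsDensityOn L ξ D)
    (hH : GrowthH H p c d) (hL : ∀ g, L g ≤ energy H (G + g) - energy H G)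
    (hD : MeasurableSet D) (hμD : μ D ≠ ⊤) :
    ∀ᵐ x ∂μ.restrict D, ξ x ∈ subdiff H (G x) := by
  filter_upwards [ae_all_iff.2 fun n =>
    hξ.ae_inner_le hH hL hD hμD (TopologicalSpace.denseSeq (E N) n)] with x hx
  exact mem_subdiff_of_denseRange hH.continuous (TopologicalSpace.denseRange_denseSeq (E N)) hx

theorem exists_selection_of_le_energy [SigmaFinite μ] (hH : GrowthH H p c d)
    (hL : ∀ g, L g ≤ energy H (G + g) - energy H G) :
    ∃ ξ : α → E N, MemLp ξ (ENNReal.conjExponent (ENNReal.ofReal p)) μ ∧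
      (∀ᵐ x ∂μ, ξ x ∈ subdiff H (G x)) ∧
      ∀ g : Lp (E N) (ENNReal.ofReal p) μ, L g = ∫ x, inner ℝ (ξ x) (g x) ∂μ := by
  set D : ℕ → Set α := disjointed (spanningSets μ) with hDdef
  have hD : ∀ n, MeasurableSet (D n) := .disjointed (measurableSet_spanningSets μ)
  have hμD (n) : μ (D n) ≠ ⊤ :=
    measure_ne_top_of_subset (disjointed_subset _ n) (measure_spanningSets_lt_top μ n).ne
  have hd : Pairwise (Function.onFun Disjoint D) := disjoint_disjointed _
  have hU : ⋃ n, D n = Set.univ := by rw [hDdef, iUnion_disjointed, iUnion_spanningSets]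
  obtain ⟨ξ, hξ⟩ := exists_forall_isDensityOn ENNReal.ofReal_ne_top L hD hμD hd
  have hμU : μ.restrict (⋃ n, D n) = μ := by rw [hU, Measure.restrict_univ]
  have hmeas : AEStronglyMeasurable ξ μ :=
    hμU ▸ AEStronglyMeasurable.iUnion fun n => (hξ n).integrableOn.1
  have hsub : ∀ᵐ x ∂μ, ξ x ∈ subdiff H (G x) := by
    have h := (ae_restrict_iUnion_iff D fun x => ξ x ∈ subdiff H (G x)).2 fun n =>
      (hξ n).ae_mem_subdiff hH hL (hD n) (hμD n)
    rwa [hμU] at h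
  have hmem := hH.memLp_of_mem_subdiff one_le_of_fact (Lp.memLp G) hmeas hsub
  have : Fact (1 ≤ ENNReal.conjExponent (ENNReal.ofReal p)) := ⟨le_self_add⟩
  have hLξ : L = innerLp (ENNReal.ofReal p) hmem := eq_of_isDensityOn ENNReal.ofReal_ne_top hD hd hU
    hξ fun n => isDensityOn_innerLp hmem (hμD n)
  exact ⟨ξ, hmem, hsub, fun g => by rw [hLξ, innerLp_apply]⟩

end Selection

section Gradient

variable {X : Type*} [NormedAddCommGroup X] [InnerProductSpace ℝ X] [CompleteSpace X]
  {φ ψ : X → ℝ} {x : X}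

theorem gradient_fun_add (hφ : DifferentiableAt ℝ φ x) (hψ : DifferentiableAt ℝ ψ x) :
    gradient (fun y => φ y + ψ y) x = gradient φ x + gradient ψ x := by
  simp only [gradient, fderiv_fun_add hφ hψ, map_add]

theorem gradient_fun_const_mul (hφ : DifferentiableAt ℝ φ x) (a : ℝ) :
    gradient (fun y => a * φ y) x = a • gradient φ x := by
  simp only [gradient, fderiv_const_mul hφ, map_smul]

theorem continuous_gradient (hφ : ContDiff ℝ 1 φ) : Continuous (gradient φ) :=
  (InnerProductSpace.toDual ℝ X).symm.continuous.comp (hφ.continuous_fderiv one_ne_zero)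

theorem hasCompactSupport_gradient (hφ : HasCompactSupport φ) : HasCompactSupport (gradient φ) :=
  (hφ.fderiv ℝ).comp_left (map_zero (InnerProductSpace.toDual ℝ X).symm)

end Gradient

namespace IsTest

variable {N : ℕ} {Ω : Set (E N)} {φ ψ : E N → ℝ}

theorem differentiableAt (hφ : IsTest Ω φ) (x : E N) : DifferentiableAt ℝ φ x :=
  (hφ.smooth.differentiable (by simp)).differentiableAt

theorem add (hφ : IsTest Ω φ) (hψ : IsTest Ω ψ) : IsTest Ω (fun x => φ x + ψ x) where
  smooth := hφ.smooth.add hψ.smooth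
  compact := hφ.compact.add hψ.compact
  supp := (tsupport_add φ ψ).trans (Set.union_subset hφ.supp hψ.supp)

theorem const_mul (hφ : IsTest Ω φ) (a : ℝ) : IsTest Ω (fun x => a * φ x) where
  smooth := contDiff_const.mul hφ.smooth
  compact := hφ.compact.mul_left
  supp := (closure_mono (Function.support_mul_subset_right _ _)).trans hφ.supp

theorem continuous_gradient (hφ : IsTest Ω φ) : Continuous (gradient φ) :=
  EnergyCritical.continuous_gradient (hφ.smooth.of_le (by simp))

variable {μ : Measure (E N)}

theorem integrable_smul_gradient (hφ : IsTest Ω φ) {u : E N → ℝ} (hu : LocallyIntegrable u μ) :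
    Integrable (fun x => u x • gradient φ x) μ :=
  hu.integrable_smul_right_of_hasCompactSupport hφ.continuous_gradient
    (hasCompactSupport_gradient hφ.compact)

theorem integrable_smul (hφ : IsTest Ω φ) {G : E N → E N} (hG : LocallyIntegrable G μ) :
    Integrable (fun x => φ x • G x) μ :=
  hG.integrable_smul_left_of_hasCompactSupport hφ.smooth.continuous hφ.compact

end IsTest

section TendstoELpNorm

variable {α ι F : Type*} [MeasurableSpace α] {μ : Measure α} [NormedAddCommGroup F] {q : ℝ≥0∞}
  {l : Filter ι} {f g : ι → α → F}

theorem tendsto_eLpNorm_add (hq : 1 ≤ q) (hf : ∀ i, AEStronglyMeasurable (f i) μ)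
    (hg : ∀ i, AEStronglyMeasurable (g i) μ)
    (hf0 : Tendsto (fun i => eLpNorm (f i) q μ) l (𝓝 0))
    (hg0 : Tendsto (fun i => eLpNorm (g i) q μ) l (𝓝 0)) :
    Tendsto (fun i => eLpNorm (fun x => f i x + g i x) q μ) l (𝓝 0) := by
  have h := hf0.add hg0
  rw [add_zero] at h
  exact tendsto_of_tendsto_of_tendsto_of_le_of_le tendsto_const_nhds h (fun _ => zero_le)
    fun i => eLpNorm_add_le (hf i) (hg i) hq

theorem tendsto_eLpNorm_const_smul [NormedSpace ℝ F] (a : ℝ)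
    (hf0 : Tendsto (fun i => eLpNorm (f i) q μ) l (𝓝 0)) :
    Tendsto (fun i => eLpNorm (fun x => a • f i x) q μ) l (𝓝 0) := by
  have h := ENNReal.Tendsto.const_mul (a := ‖a‖ₑ) hf0 (Or.inr enorm_ne_top)
  rw [mul_zero] at h
  exact h.congr fun i => (eLpNorm_const_smul a (f i) q μ).symm

end TendstoELpNorm

namespace W0

variable {N : ℕ} {Ω : Set (E N)} {p : ℝ}

instance : SMul ℝ (W0 Ω p) where
  smul a v :=
    { toFun := fun x => a * v.toFun x
      grad := fun x => a • v.grad x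
      memLp := v.memLp.const_mul a
      memLp_grad := v.memLp_grad.const_smul a
      isWeakGrad := fun φ hφ => by
        simp only [smul_comm _ a, mul_smul, integral_smul, v.isWeakGrad φ hφ, smul_neg]
      approx := by
        obtain ⟨φ, hφ, hφu, hφG⟩ := v.approx
        refine ⟨fun n x => a * φ n x, fun n => (hφ n).const_mul a, ?_, ?_⟩
        · simpa only [smul_eq_mul, mul_sub] using tendsto_eLpNorm_const_smul a hφu
        · simp only [gradient_fun_const_mul ((hφ _).differentiableAt _), ← smul_sub]
          exact tendsto_eLpNorm_const_smul a hφG }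

variable [Fact (1 ≤ ENNReal.ofReal p)]

instance : Add (W0 Ω p) where
  add v w :=
    { toFun := fun x => v.toFun x + w.toFun x
      grad := fun x => v.grad x + w.grad x
      memLp := v.memLp.add w.memLp
      memLp_grad := v.memLp_grad.add w.memLp_grad
      isWeakGrad := fun φ hφ => by
        have hp : 1 ≤ ENNReal.ofReal p := Fact.out
        simp only [add_smul, smul_add]
        rw [integral_add (hφ.integrable_smul_gradient (v.memLp.locallyIntegrable hp))
          (hφ.integrable_smul_gradient (w.memLp.locallyIntegrable hp)),
          integral_add (hφ.integrable_smul (v.memLp_grad.locallyIntegrable hp))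
          (hφ.integrable_smul (w.memLp_grad.locallyIntegrable hp)),
          v.isWeakGrad φ hφ, w.isWeakGrad φ hφ, neg_add]
      approx := by
        obtain ⟨φ, hφ, hφu, hφG⟩ := v.approx
        obtain ⟨ψ, hψ, hψu, hψG⟩ := w.approx
        refine ⟨fun n x => φ n x + ψ n x, fun n => (hφ n).add (hψ n), ?_, ?_⟩
        · simp only [add_sub_add_comm]
          exact tendsto_eLpNorm_add Fact.out
            (fun n => (hφ n).smooth.continuous.aestronglyMeasurable.sub v.memLp.1)
            (fun n => (hψ n).smooth.continuous.aestronglyMeasurable.sub w.memLp.1) hφu hψu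
        · simp only [gradient_fun_add ((hφ _).differentiableAt _) ((hψ _).differentiableAt _),
            add_sub_add_comm]
          exact tendsto_eLpNorm_add Fact.out
            (fun n => (hφ n).continuous_gradient.aestronglyMeasurable.sub v.memLp_grad.1)
            (fun n => (hψ n).continuous_gradient.aestronglyMeasurable.sub w.memLp_grad.1)
            hφG hψG }

end W0

section EulerLagrange

variable {N : ℕ} {Ω : Set (E N)} {p c d : ℝ} {H : E N → ℝ} {f : E N → ℝ → ℝ} {u v w : W0 Ω p}

/-- The weak gradient as an element of `L^p`. -/
noncomputable def W0.gradLp (v : W0 Ω p) : Lp (E N) (ENNReal.ofReal p) (volume.restrict Ω) :=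
  v.memLp_grad.toLp v.grad

/-- The pairing `∫ f(x, u) v` of `v` with the forcing term; it is meaningful for `v ∈ V_u`. -/
noncomputable def forcing (f : E N → ℝ → ℝ) (u v : W0 Ω p) : ℝ :=
  ∫ x in Ω, f x (u.toFun x) * v.toFun x

theorem smul_mem_V (a : ℝ) (hv : v ∈ V f u) : a • v ∈ V f u :=
  (Integrable.const_mul hv a).congr (ae_of_all _ fun _ => mul_left_comm _ _ _)

theorem gradLp_smul (a : ℝ) (v : W0 Ω p) : (a • v).gradLp = a • v.gradLp := rfl

theorem forcing_smul (f : E N → ℝ → ℝ) (u : W0 Ω p) (a : ℝ) (v : W0 Ω p) :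
    forcing f u (a • v) = a * forcing f u v :=
  (integral_congr_ae (ae_of_all _ fun _ => mul_left_comm _ _ _)).trans (integral_const_mul _ _)

theorem GrowthH.Jlin_eq (hH : GrowthH H p c d) (hp : 0 < p) (hv : v ∈ V f u) :
    Jlin H f u v = energy H v.gradLp - forcing f u v := by
  rw [Jlin, integral_sub (hH.integrable_comp hp v.memLp_grad) hv, W0.gradLp, energy_toLp, forcing]

section Add

variable [Fact (1 ≤ ENNReal.ofReal p)]

theorem add_mem_V (hv : v ∈ V f u) (hw : w ∈ V f u) : v + w ∈ V f u :=
  (Integrable.add hv hw).congr (ae_of_all _ fun _ => (mul_add _ _ _).symm)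

theorem gradLp_add (v w : W0 Ω p) : (v + w).gradLp = v.gradLp + w.gradLp := rfl

theorem forcing_add (hv : v ∈ V f u) (hw : w ∈ V f u) :
    forcing f u (v + w) = forcing f u v + forcing f u w :=
  (integral_congr_ae (ae_of_all _ fun _ => mul_add _ _ _)).trans (integral_add hv hw)

/-- The graph of `Dv ↦ ∫ f(x, u) v` over `v ∈ V_u`. It is introduced as a relation because `Dv` is
not known beforehand to determine the integral. -/
noncomputable def forcingGraph (hu : u ∈ V f u) :
    Submodule ℝ (Lp (E N) (ENNReal.ofReal p) (volume.restrict Ω) × ℝ) where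
  carrier := (fun v => (v.gradLp, forcing f u v)) '' V f u
  add_mem' := by
    rintro _ _ ⟨v, hv, rfl⟩ ⟨w, hw, rfl⟩
    exact ⟨v + w, add_mem_V hv hw, Prod.ext (gradLp_add v w) (forcing_add hv hw)⟩
  zero_mem' := by
    refine ⟨(0 : ℝ) • u, smul_mem_V 0 hu, Prod.ext ?_ ?_⟩
    · exact (gradLp_smul 0 u).trans (zero_smul ℝ _)
    · exact (forcing_smul f u 0 u).trans (zero_mul _)
  smul_mem' := by
    rintro a _ ⟨v, hv, rfl⟩
    exact ⟨a • v, smul_mem_V a hv, Prod.ext (gradLp_smul a v) (forcing_smul f u a v)⟩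

theorem forcing_le_energy_sub (hH : GrowthH H p c d) (hu : u ∈ V f u)
    (hmin : ∀ v ∈ V f u, Jlin H f u u ≤ Jlin H f u v) (hw : w ∈ V f u) :
    forcing f u w ≤ energy H (u.gradLp + w.gradLp) - energy H u.gradLp := by
  have hp : 0 < p := zero_lt_one.trans_le one_le_of_fact
  have huw := add_mem_V hu hw
  have h := hmin _ huw
  rw [hH.Jlin_eq hp hu, hH.Jlin_eq hp huw, gradLp_add, forcing_add hu hw] at h
  linarith

end Add

theorem integrable_inner_of_memLp {α F : Type*} [MeasurableSpace α] {μ : Measure α}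
    [NormedAddCommGroup F] [InnerProductSpace ℝ F] {q q' : ℝ≥0∞} [ENNReal.HolderConjugate q' q]
    {ξ G : α → F} (hξ : MemLp ξ q' μ) (hG : MemLp G q μ) :
    Integrable (fun x => inner ℝ (ξ x) (G x)) μ :=
  memLp_one_iff_integrable.1 ((innerSL ℝ).memLp_of_bilin 1 hξ hG)

theorem integral_inner_sub_forcing (hp : 1 ≤ p) {ξ : E N → E N}
    (hξ : MemLp ξ (ENNReal.conjExponent (ENNReal.ofReal p)) (volume.restrict Ω))
    (hv : v ∈ V f u) :
    ∫ x in Ω, (inner ℝ (ξ x) (v.grad x) - f x (u.toFun x) * v.toFun x) =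
      (∫ x in Ω, inner ℝ (ξ x) (v.grad x)) - forcing f u v := by
  have : Fact (1 ≤ ENNReal.ofReal p) := ⟨by simpa using hp⟩
  exact integral_sub (integrable_inner_of_memLp hξ v.memLp_grad) hv

theorem exists_solvesEL (hH : GrowthH H p c d) (hp : 1 ≤ p) (hu : u ∈ V f u)
    (hmin : ∀ v ∈ V f u, Jlin H f u u ≤ Jlin H f u v) : ∃ ξ, SolvesEL H f u ξ := by
  have : Fact (1 ≤ ENNReal.ofReal p) := ⟨by simpa using hp⟩
  have hconv : ConvexOn ℝ Set.univ fun g => energy H (u.gradLp + g) - energy H u.gradLp :=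
    ((hH.convexOn_energy (zero_lt_one.trans_le hp)).translate_right u.gradLp).sub
      (concaveOn_const _ convex_univ)
  have hcont : Continuous fun g => energy H (u.gradLp + g) - energy H u.gradLp :=
    (hH.continuous_energy.comp (continuous_const_add _)).sub continuous_const
  have hle : ∀ w ∈ forcingGraph hu, w.2 ≤ energy H (u.gradLp + w.1) - energy H u.gradLp := by
    rintro _ ⟨w, hw, rfl⟩
    exact forcing_le_energy_sub hH hu hmin hw
  obtain ⟨L, hL, hLf⟩ := exists_continuousLinearMap_le_of_convexOn hconv hcont hle
  obtain ⟨ξ, hξ, hsub, hLξ⟩ := exists_selection_of_le_energy hH hL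
  refine ⟨ξ, hξ, ?_, fun φ hφ => ?_⟩
  · filter_upwards [hsub, u.memLp_grad.coeFn_toLp] with x hx hux
    exact hux ▸ hx
  · have hint : ∫ x in Ω, inner ℝ (ξ x) (φ.gradLp x) = ∫ x in Ω, inner ℝ (ξ x) (φ.grad x) :=
      integral_congr_ae (φ.memLp_grad.coeFn_toLp.mono fun x hx => congrArg (inner ℝ (ξ x)) hx)
    rw [integral_inner_sub_forcing hp hξ hφ, ← hint, ← hLξ, sub_eq_zero]
    exact hLf _ ⟨φ, hφ, rfl⟩

end EulerLagrange

section Euler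

variable {N : ℕ} {H : E N → ℝ} {p : ℝ}

/-- Both sides agree at `t = 0`, so their derivatives there do too. -/
theorem eq_mul_of_forall_mul_le {a h : ℝ}
    (hle : ∀ t : ℝ, -1 < t → t * a ≤ (1 + t) ^ p * h - h) : a = p * h := by
  have hderiv : HasDerivAt (fun t : ℝ => (1 + t) ^ p * h - h - t * a) (p * h - a) 0 := by
    have hpow : HasDerivAt (fun t : ℝ => (1 + t) ^ p) p 0 := by
      simpa using ((hasDerivAt_id (0 : ℝ)).const_add 1).rpow_const (p := p) (Or.inl (by simp))
    simpa using! ((hpow.mul_const h).sub_const h).sub ((hasDerivAt_id (0 : ℝ)).mul_const a)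
  have hmin : IsLocalMin (fun t : ℝ => (1 + t) ^ p * h - h - t * a) 0 := by
    filter_upwards [Ioi_mem_nhds neg_one_lt_zero] with t ht
    rw [add_zero, Real.one_rpow, one_mul, sub_self, zero_mul, sub_zero]
    exact sub_nonneg.2 (hle t ht)
  exact (sub_eq_zero.1 (hmin.hasDerivAt_eq_zero hderiv)).symm

theorem PosHomogeneous.inner_eq (hH : PosHomogeneous H p) {z ξ : E N} (hξ : ξ ∈ subdiff H z) :
    inner ℝ ξ z = p * H z := by
  refine eq_mul_of_forall_mul_le fun t ht => ?_
  calc t * inner ℝ ξ z = inner ℝ ξ (t • z) := (inner_smul_right _ _ _).symm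
    _ ≤ H (z + t • z) - H z := hξ _
    _ = (1 + t) ^ p * H z - H z := by
      rw [← hH (1 + t) (by linarith) z, add_smul, one_smul]

theorem SolvesEL.ae_inner_eq {Ω : Set (E N)} {f : E N → ℝ → ℝ} {u : W0 Ω p} {ξ : E N → E N}
    (hξ : SolvesEL H f u ξ) (hH : PosHomogeneous H p) :
    ∀ᵐ x ∂(volume.restrict Ω), inner ℝ (ξ x) (u.grad x) = p * H (u.grad x) :=
  hξ.mem_subdiff.mono fun _ => hH.inner_eq

theorem SolvesEL.mul_integral_eq {Ω : Set (E N)} {f : E N → ℝ → ℝ} {u : W0 Ω p} {ξ : E N → E N}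
    (hξ : SolvesEL H f u ξ) (hp : 1 ≤ p) (hu : u ∈ V f u) (hH : PosHomogeneous H p) :
    p * ∫ x in Ω, H (u.grad x) = ∫ x in Ω, f x (u.toFun x) * u.toFun x := by
  calc p * ∫ x in Ω, H (u.grad x) = ∫ x in Ω, inner ℝ (ξ x) (u.grad x) := by
        rw [integral_congr_ae (hξ.ae_inner_eq hH), integral_const_mul]
    _ = ∫ x in Ω, f x (u.toFun x) * u.toFun x :=
        sub_eq_zero.1 <| (integral_inner_sub_forcing hp hξ.memLp hu).symm.trans (hξ.eq u hu)

end Euler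

end EnergyCritical

theorem mainTheorem7_general {N : ℕ} {Ω : Set (EnergyCritical.E N)} {p c d : ℝ} (hp : 1 ≤ p)
    {H : EnergyCritical.E N → ℝ} (hH : EnergyCritical.GrowthH H p c d)
    {f : EnergyCritical.E N → ℝ → ℝ} {u : EnergyCritical.W0 Ω p} (hu : u ∈ EnergyCritical.V f u)
    (hmin : ∀ v ∈ EnergyCritical.V f u,
      EnergyCritical.Jlin H f u u ≤ EnergyCritical.Jlin H f u v) :
    (∃ ξ : EnergyCritical.E N → EnergyCritical.E N, EnergyCritical.SolvesEL H f u ξ) ∧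
    (EnergyCritical.PosHomogeneous H p →
      (∀ ξ : EnergyCritical.E N → EnergyCritical.E N, EnergyCritical.SolvesEL H f u ξ →
        ∀ᵐ x ∂(volume.restrict Ω), inner ℝ (ξ x) (u.grad x) = p * H (u.grad x)) ∧
      p * ∫ x in Ω, H (u.grad x) = ∫ x in Ω, f x (u.toFun x) * u.toFun x) := by
  obtain ⟨ξ, hξ⟩ := EnergyCritical.exists_solvesEL hH hp hu hmin
  exact ⟨⟨ξ, hξ⟩, fun hhom =>
    ⟨fun η hη => hη.ae_inner_eq hhom, hξ.mul_integral_eq hp hu hhom⟩⟩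

theorem mainTheorem7 {N : ℕ} (hN : 1 ≤ N) (Ω : Set (EnergyCritical.E N)) (hΩ : IsOpen Ω)
    (hΩfin : volume Ω < ⊤) (p c d : ℝ) (hp : 1 ≤ p)
    (H : EnergyCritical.E N → ℝ) (hH : EnergyCritical.GrowthH H p c d)
    (f : EnergyCritical.E N → ℝ → ℝ) (hf : EnergyCritical.LocBddCaratheodory Ω f)
    (hfg : p ≤ N → EnergyCritical.OneSidedGrowth Ω p f)
    (u : EnergyCritical.W0 Ω p) (hu : EnergyCritical.IsEnergyCritical H f u) :
    (∃ ξ : EnergyCritical.E N → EnergyCritical.E N, EnergyCritical.SolvesEL H f u ξ) ∧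
    (EnergyCritical.PosHomogeneous H p →
      (∀ ξ : EnergyCritical.E N → EnergyCritical.E N, EnergyCritical.SolvesEL H f u ξ →
        ∀ᵐ x ∂(volume.restrict Ω), inner ℝ (ξ x) (u.grad x) = p * H (u.grad x)) ∧
      p * ∫ x in Ω, H (u.grad x) = ∫ x in Ω, f x (u.toFun x) * u.toFun x) :=
  mainTheorem7_general hp hH hu.mem hu.min
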